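/- Let $u:(0,\infty)\to[0,\infty)$ be the Lévy density of a subordinator, i.e. $\int_0^\infty \min(1,x)\,u(x)\,dx<\infty$. Let $n\ge 1$ and $m\ge n+2$ be integers and $r>0$, and suppose that $u$ is $m$ times continuously differentiable on $(0,\infty)$ with $$\int_0^\infty e^{-rx}x^{k+1}|u^{(k)}(x)|\,dx<\infty,\qquad k=0,1,\dots,m.$$ For functions $f,g$ on $(0,\infty)$ write $(f*g)(x)=\int_0^x f(y)g(x-y)\,dy$, $f^{*1}=f$ and $f^{*(k+1)}=f^{*k}*f$. (i) Let $U^+(x)=\int_x^\infty u(y)\,dy$ for $x>0$. Then $U^+$ is finite, the convolution power $(U^+)^{*n}(x)$ is well defined for every $x>0$ (all the convolution integrals involved converge absolutely), and $(U^+)^{*n}$ is $n$ times continuously differentiable on $(0,\infty)$. (ii) For $\varepsilon>0$ let $u_\varepsilon(x)=e^{-\varepsilon/x}u(x)$, $x>0$, and $c(\varepsilon)=\int_0^\infty u_\varepsilon(x)\,dx$. Then $c(\varepsilon)<\infty$, the convolution powers $u_\varepsilon^{*k}(x)$, $1\le k\le n$, are well defined for every $x>0$, and with $$u_{n\varepsilon}(x)=\sum_{k=1}^n(-1)^{n-k}\binom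 nk u_\varepsilon^{*k}(x)\,c(\varepsilon)^{n-k}$$ one has, for every $x>0$, $$\lim_{\varepsilon\downarrow0}u_{n\varepsilon}(x)=u_n(x),\qquad u_n(x)=(-1)^n\frac{d^n}{dx^n}(U^+)^{*n}(x).$$ -/

import Mathlib

open MeasureTheory Set Filter Topology

noncomputable section

/-- `u`, restricted to `(0, ∞)`, is the density of the Lévy measure of a subordinator: it is
nonnegative and `∫₀^∞ min(1, x) u(x) dx < ∞`. The values of `u` on `(-∞, 0]` play no role. -/
structure IsSubordinatorLevyDensity (u : ℝ → ℝ) : Prop where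
  nonneg : ∀ x : ℝ, 0 < x → 0 ≤ u x
  integrable_min : IntegrableOn (fun x : ℝ => min 1 x * u x) (Ioi 0)

/-- The convolution of functions on `(0, ∞)`: `(f * g)(x) = ∫₀ˣ f(y) g(x - y) dy` for `x > 0`. -/
def halfConv (f g : ℝ → ℝ) : ℝ → ℝ :=
  posConvolution f g (ContinuousLinearMap.mul ℝ ℝ) volume

/-- The convolution powers `f^{*n}`, `n ≥ 1`, of a function on `(0, ∞)`:
`f^{*1} = f` and `f^{*(n+1)} = f^{*n} * f`. The value at `n = 0` is a placeholder. -/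
def convPow (f : ℝ → ℝ) : ℕ → ℝ → ℝ
  | 0 => 0
  | 1 => f
  | n + 2 => halfConv (convPow f (n + 1)) f

/-- The convolution powers of `f` up to order `n` are well defined at every point of `(0, ∞)`:
all the convolution integrals involved converge absolutely. -/
def ConvPowExists (f : ℝ → ℝ) (n : ℕ) : Prop :=
  ∀ k : ℕ, 1 ≤ k → k < n → ∀ x : ℝ, 0 < x →
    IntervalIntegrable (fun y : ℝ => convPow f k y * f (x - y)) volume 0 x

/-- The upper tail integral `U⁺(x) = ∫ₓ^∞ u(y) dy`. -/
def tailIntegral (u : ℝ → ℝ) (x : ℝ) : ℝ := ∫ y in Ioi x, u y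

/-- The approximation `u_ε(x) = e^{-ε/x} u(x)`. -/
def uEps (u : ℝ → ℝ) (ε : ℝ) (x : ℝ) : ℝ := Real.exp (-ε / x) * u x

/-- The total mass `c(ε) = ∫₀^∞ u_ε(x) dx`. -/
def cEps (u : ℝ → ℝ) (ε : ℝ) : ℝ := ∫ x in Ioi (0 : ℝ), uEps u ε x

/-- `u_{nε}(x) = ∑_{k=1}^n (-1)^{n-k} (n choose k) u_ε^{*k}(x) c(ε)^{n-k}`. -/
def unEps (u : ℝ → ℝ) (n : ℕ) (ε : ℝ) (x : ℝ) : ℝ :=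
  ∑ k ∈ Finset.Icc 1 n,
    (-1 : ℝ) ^ (n - k) * (n.choose k : ℝ) * convPow (uEps u ε) k x * cEps u ε ^ (n - k)

end

/-! Write V_ε for the tail integral of u_ε, c for c(ε), E for the constant 1 on (0, ∞), and δ for
the Dirac mass at 0.

For ε > 0 the function u_ε is integrable, so V_ε = c - E * u_ε = E * (cδ - u_ε), hence V_ε^{*n} =
E^{*n} * (cδ - u_ε)^{*n}. Convolution with E is integration from 0, so n derivatives on (0, ∞)
remove E^{*n}, and the part c^n δ leaves nothing there. The binomial theorem then gives u_{nε} =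
(-1)^n D^n V_ε^{*n} (`iteratedDeriv_convPow_tailIntegral`).

It remains to let ε ↓ 0 in D^n V_ε^{*n}. Ordinary derivatives cannot be moved onto the factors,
since V_0' = -u need not be integrable at 0. The Euler operator θ = x d/dx can: the substitution y =
xt gives θ(f * g) = f * g + θf * g + f * θg (`IsMajorizedFamily.hasDerivAt_halfConv`). It therefore
suffices that V_ε, θV_ε, ..., θ^n V_ε converge pointwise and are bounded, uniformly in ε, by
antitone functions integrable near 0. Such bounds survive convolution and permit dominated
convergence, and D^n is recovered from powers of θ (`contDiffOn_div_pow_and_tendsto`).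

For the bounds, V_ε ≤ V_0. Since θV_ε = -x u_ε, the higher iterates are combinations of (ε/x)^i
e^{-ε/x} x^{j+1} u^{(j)}(x). The prefactor is at most i!, and x^{j+1} u^{(j)} is controlled by
integrating its derivative (`exists_majorant_of_hasDerivAt`). -/

/-! ### Antitone majorants and their convolutions -/

/-- A nonnegative antitone integrable function on `(0, b)`, used as a bound for functions with an
integrable singularity at `0`. -/
structure IsMajorant (b : ℝ) (H : ℝ → ℝ) : Prop where
  antitoneOn : AntitoneOn H (Ioo 0 b)
  integrableOn : IntegrableOn H (Ioo 0 b)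
  nonneg : ∀ x ∈ Ioo 0 b, 0 ≤ H x

namespace IsMajorant

variable {a b c : ℝ} {H K : ℝ → ℝ}

theorem add (hH : IsMajorant b H) (hK : IsMajorant b K) : IsMajorant b fun x => H x + K x where
  antitoneOn := hH.antitoneOn.add hK.antitoneOn
  integrableOn := hH.integrableOn.add hK.integrableOn
  nonneg x hx := add_nonneg (hH.nonneg x hx) (hK.nonneg x hx)

theorem const_mul (hH : IsMajorant b H) (hc : 0 ≤ c) : IsMajorant b fun x => c * H x where
  antitoneOn _ hx _ hy hxy := mul_le_mul_of_nonneg_left (hH.antitoneOn hx hy hxy) hc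
  integrableOn := hH.integrableOn.const_mul c
  nonneg x hx := mul_nonneg hc (hH.nonneg x hx)

theorem const (hc : 0 ≤ c) : IsMajorant b fun _ => c where
  antitoneOn _ _ _ _ _ := le_rfl
  integrableOn := integrableOn_const (by simp)
  nonneg _ _ := hc

theorem intervalIntegrable (hH : IsMajorant b H) (ha : 0 ≤ a) (hab : a < b) :
    IntervalIntegrable H volume 0 a :=
  (intervalIntegrable_iff_integrableOn_Ioc_of_le ha).2
    (hH.integrableOn.mono_set fun _ hx => ⟨hx.1, hx.2.trans_lt hab⟩)

theorem comp_half (hH : IsMajorant b H) : IsMajorant b fun x => H (x / 2) where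
  antitoneOn x hx y hy hxy :=
    hH.antitoneOn ⟨half_pos hx.1, by linarith [hx.2, hx.1]⟩ ⟨half_pos hy.1, by linarith [hy.2, hy.1]⟩
      (by linarith)
  integrableOn := by
    rcases le_or_gt b 0 with hb | hb
    · simp [Ioo_eq_empty (not_lt.2 hb)]
    · have h := (hH.intervalIntegrable (half_pos hb).le (half_lt_self hb))
      have h2 := (intervalIntegrable_iff_integrableOn_Ioc_of_le (half_pos hb).le).1 h
      have h3 : IntegrableOn (fun x => H (x / 2)) (Ioc 0 b) := by
        rw [← intervalIntegrable_iff_integrableOn_Ioc_of_le hb.le]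
        have := h.comp_mul_left (c := 2⁻¹)
        simpa [div_eq_inv_mul] using this
      exact h3.mono_set Ioo_subset_Ioc_self
  nonneg x hx := hH.nonneg _ ⟨half_pos hx.1, by linarith [hx.2, hx.1]⟩

/-- For `y ≤ a / 2` the argument `a - y` stays above `a / 2`, so monotonicity replaces the second
factor by a constant. -/
theorem half_mul (hH : IsMajorant b H) (hK : IsMajorant b K) (ha : 0 < a) (hab : a < b) :
    IntervalIntegrable (fun y => H y * K (a - y)) volume 0 (a / 2) ∧
      ∫ y in 0..a / 2, H y * K (a - y) ≤ K (a / 2) * ∫ y in Ioo 0 b, H y := by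
  have h2 : 0 < a / 2 := half_pos ha
  have hHi := hH.intervalIntegrable h2.le (by linarith : a / 2 < b)
  have hle : ∀ y ∈ Ioc 0 (a / 2), K (a - y) ≤ K (a / 2) := fun y hy =>
    hK.antitoneOn ⟨h2, by linarith⟩ ⟨by linarith [hy.2], by linarith [hy.1]⟩ (by linarith [hy.2])
  have hnn : ∀ y ∈ Ioc 0 (a / 2), 0 ≤ K (a - y) := fun y hy =>
    hK.nonneg _ ⟨by linarith [hy.2], by linarith [hy.1]⟩
  have hint : IntervalIntegrable (fun y => H y * K (a - y)) volume 0 (a / 2) := by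
    rw [intervalIntegrable_iff_integrableOn_Ioc_of_le h2.le] at hHi ⊢
    have hmono : MonotoneOn (fun y => K (a - y)) (Ioc 0 (a / 2)) := fun x hx y hy hxy =>
      hK.antitoneOn ⟨by linarith [hy.2], by linarith [hy.1]⟩ ⟨by linarith [hx.2], by linarith [hx.1]⟩
        (by linarith)
    refine Integrable.mul_bdd (c := K (a / 2)) hHi
      (aemeasurable_restrict_of_monotoneOn measurableSet_Ioc hmono).aestronglyMeasurable ?_
    filter_upwards [ae_restrict_mem measurableSet_Ioc] with y hy
    rw [Real.norm_of_nonneg (hnn y hy)]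
    exact hle y hy
  refine ⟨hint, ?_⟩
  calc ∫ y in 0..a / 2, H y * K (a - y) ≤ ∫ y in 0..a / 2, K (a / 2) * H y := by
        refine intervalIntegral.integral_mono_on_of_le_Ioo h2.le hint (hHi.const_mul _) fun y hy => ?_
        rw [mul_comm]
        exact mul_le_mul_of_nonneg_right (hle y ⟨hy.1, hy.2.le⟩)
          (hH.nonneg y ⟨hy.1, by linarith [hy.2]⟩)
    _ = K (a / 2) * ∫ y in Ioc 0 (a / 2), H y := by
        rw [intervalIntegral.integral_const_mul, intervalIntegral.integral_of_le h2.le]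
    _ ≤ _ := by
        refine mul_le_mul_of_nonneg_left ?_ (hK.nonneg _ ⟨h2, by linarith⟩)
        refine setIntegral_mono_set hH.integrableOn ?_ (LE.le.eventuallyLE ?_)
        · filter_upwards [ae_restrict_mem measurableSet_Ioo] with y hy using hH.nonneg y hy
        · exact fun y hy => ⟨hy.1, by linarith [hy.2]⟩

/-- The reflection `y ↦ a - y` reduces the upper half of the interval to the lower one with the
factors exchanged. As a function of `a` the bound is again a majorant, so the class is stable under
convolution. -/
theorem intervalIntegrable_mul_sub_and_le (hH : IsMajorant b H) (hK : IsMajorant b K)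
    (ha : 0 < a) (hab : a < b) :
    IntervalIntegrable (fun y => H y * K (a - y)) volume 0 a ∧
      ∫ y in 0..a, H y * K (a - y) ≤
        (∫ y in Ioo 0 b, H y) * K (a / 2) + (∫ y in Ioo 0 b, K y) * H (a / 2) := by
  obtain ⟨h1, h1'⟩ := half_mul hH hK ha hab
  obtain ⟨h2, h2'⟩ := half_mul hK hH ha hab
  have h3 := (h2.comp_sub_left a).symm
  have h4 : ∫ y in a / 2..a, H y * K (a - y) = ∫ y in 0..a / 2, K y * H (a - y) := by
    have := intervalIntegral.integral_comp_sub_left (a := a / 2) (b := a)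
      (fun y => K y * H (a - y)) a
    rw [sub_self, sub_half] at this
    rw [← this]
    congr 1 with y
    rw [sub_sub_cancel, mul_comm]
  simp only [sub_sub_cancel, sub_half, sub_zero] at h3
  have h5 : IntervalIntegrable (fun y => H y * K (a - y)) volume (a / 2) a := by
    simpa only [mul_comm] using h3
  refine ⟨h1.trans h5, ?_⟩
  rw [← intervalIntegral.integral_add_adjacent_intervals h1 h5, h4]
  linarith [mul_comm (K (a / 2)) (∫ y in Ioo 0 b, H y), mul_comm (H (a / 2)) (∫ y in Ioo 0 b, K y)]

theorem intervalIntegrable_mul_sub (hH : IsMajorant b H) (hK : IsMajorant b K)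
    (ha : 0 < a) (hab : a < b) : IntervalIntegrable (fun y => H y * K (a - y)) volume 0 a :=
  (hH.intervalIntegrable_mul_sub_and_le hK ha hab).1

theorem intervalIntegrable_dilate (hH : IsMajorant b H) (hK : IsMajorant b K)
    (ha : 0 < a) (hab : a < b) :
    IntervalIntegrable (fun t => H (a * t) * K (a * (1 - t))) volume 0 1 := by
  have := (hH.intervalIntegrable_mul_sub hK ha hab).comp_mul_left (c := a)
  rw [zero_div, div_self ha.ne'] at this
  simpa only [mul_sub, mul_one] using this

end IsMajorant

/-! ### Convolution on the half-line and its dilated form -/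

theorem halfConv_apply (f g : ℝ → ℝ) {x : ℝ} (hx : 0 < x) :
    halfConv f g x = ∫ y in 0..x, f y * g (x - y) := by
  simp [halfConv, posConvolution, hx]

theorem halfConv_of_nonpos (f g : ℝ → ℝ) {x : ℝ} (hx : x ≤ 0) : halfConv f g x = 0 := by
  simp [halfConv, posConvolution, hx]

theorem halfConv_congr {f f' g g' : ℝ → ℝ} (hf : EqOn f f' (Ioi 0)) (hg : EqOn g g' (Ioi 0)) :
    halfConv f g = halfConv f' g' := by
  simp only [halfConv, posConvolution_eq_convolution_indicator]
  rw [indicator_congr hf, indicator_congr hg]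

/-- The substitution `y = x t` makes the domain independent of `x`. Differentiation in `x` then has
no boundary term and acts on each factor through `x d/dx`. -/
theorem halfConv_dilate (f g : ℝ → ℝ) {x : ℝ} (hx : 0 < x) :
    halfConv f g x = x * ∫ t in 0..1, f (x * t) * g (x * (1 - t)) := by
  have := intervalIntegral.smul_integral_comp_mul_left (a := 0) (b := 1)
    (fun y => f y * g (x - y)) x
  rw [halfConv_apply f g hx, mul_zero, mul_one] at *
  rw [← this, smul_eq_mul]
  simp only [mul_sub, mul_one]

theorem ae_mem_Ioo_of_mem_uIoc {a b : ℝ} (hab : a ≤ b) : ∀ᵐ t : ℝ, t ∈ uIoc a b → t ∈ Ioo a b := by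
  filter_upwards [compl_mem_ae_iff.2 (measure_singleton b)] with t ht h
  rw [uIoc_of_le hab] at h
  exact ⟨h.1, lt_of_le_of_ne h.2 ht⟩

theorem aestronglyMeasurable_uIoc_of_continuousOn {a b : ℝ} (hab : a ≤ b) {f : ℝ → ℝ}
    (hf : ContinuousOn f (Ioo a b)) :
    AEStronglyMeasurable f (volume.restrict (uIoc a b)) := by
  rw [uIoc_of_le hab, ← restrict_Ioo_eq_restrict_Ioc]
  exact hf.aestronglyMeasurable measurableSet_Ioo

section Pointwise

variable {f g H K : ℝ → ℝ} {a b x : ℝ}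

theorem continuousOn_mul_sub (hf : ContinuousOn f (Ioi 0)) (hg : ContinuousOn g (Ioi 0)) :
    ContinuousOn (fun y => f y * g (x - y)) (Ioo 0 x) :=
  (hf.mono fun _ hy => hy.1).mul
    (hg.comp (by fun_prop) fun _ hy => sub_pos.2 hy.2)

theorem continuousOn_dilate (hf : ContinuousOn f (Ioi 0)) (hg : ContinuousOn g (Ioi 0))
    (hx : 0 < x) : ContinuousOn (fun t => f (x * t) * g (x * (1 - t))) (Ioo 0 1) :=
  (hf.comp (by fun_prop) fun _ ht => mul_pos hx ht.1).mul
    (hg.comp (by fun_prop) fun _ ht => mul_pos hx (sub_pos.2 ht.2))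

/-- Because majorants are antitone, their values at the left end `a` dominate the integrand for all
`x` in `[a, b)` at once, which gives the dominating function for continuity and differentiation in
`x`. -/
theorem abs_dilate_le (hH : IsMajorant b H) (hK : IsMajorant b K)
    (hf : ∀ x ∈ Ioo 0 b, |f x| ≤ H x) (hg : ∀ x ∈ Ioo 0 b, |g x| ≤ K x)
    (ha : 0 < a) (hax : a ≤ x) (hxb : x < b) {t : ℝ} (ht : t ∈ Ioo (0 : ℝ) 1) :
    |f (x * t) * g (x * (1 - t))| ≤ H (a * t) * K (a * (1 - t)) := by
  have key : ∀ s ∈ Ioo (0 : ℝ) 1, a * s ∈ Ioo 0 b ∧ x * s ∈ Ioo 0 b ∧ a * s ≤ x * s := by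
    intro s hs
    have h1 : a * s ≤ x * s := mul_le_mul_of_nonneg_right hax hs.1.le
    have h2 : x * s < b := lt_of_le_of_lt (mul_le_of_le_one_right (ha.le.trans hax) hs.2.le) hxb
    have h3 : 0 < a * s := mul_pos ha hs.1
    exact ⟨⟨h3, h1.trans_lt h2⟩, ⟨h3.trans_le h1, h2⟩, h1⟩
  obtain ⟨h1, h2, h3⟩ := key t ht
  obtain ⟨k1, k2, k3⟩ := key (1 - t) ⟨sub_pos.2 ht.2, by linarith [ht.1]⟩
  rw [abs_mul]
  exact mul_le_mul ((hf _ h2).trans (hH.antitoneOn h1 h2 h3))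
    ((hg _ k2).trans (hK.antitoneOn k1 k2 k3)) (abs_nonneg _) (hH.nonneg _ h1)

theorem abs_mul_sub_le (hH : IsMajorant b H)
    (hf : ∀ x ∈ Ioo 0 b, |f x| ≤ H x) (hg : ∀ x ∈ Ioo 0 b, |g x| ≤ K x)
    (hxb : x < b) {y : ℝ} (hy : y ∈ Ioo (0 : ℝ) x) :
    |f y * g (x - y)| ≤ H y * K (x - y) := by
  rw [abs_mul]
  exact mul_le_mul (hf _ ⟨hy.1, hy.2.trans hxb⟩) (hg _ ⟨sub_pos.2 hy.2, by linarith [hy.1]⟩)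
    (abs_nonneg _) (hH.nonneg _ ⟨hy.1, hy.2.trans hxb⟩)

theorem intervalIntegrable_mul_sub_of_majorant (hH : IsMajorant b H) (hK : IsMajorant b K)
    (hf : ∀ x ∈ Ioo 0 b, |f x| ≤ H x) (hg : ∀ x ∈ Ioo 0 b, |g x| ≤ K x)
    (hfc : ContinuousOn f (Ioi 0)) (hgc : ContinuousOn g (Ioi 0)) (hx : 0 < x) (hxb : x < b) :
    IntervalIntegrable (fun y => f y * g (x - y)) volume 0 x := by
  refine (hH.intervalIntegrable_mul_sub hK hx hxb).mono_fun'
    (aestronglyMeasurable_uIoc_of_continuousOn hx.le (continuousOn_mul_sub hfc hgc)) ?_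
  refine (ae_restrict_iff' measurableSet_uIoc).2 ?_
  filter_upwards [ae_mem_Ioo_of_mem_uIoc hx.le] with y hy hy'
  exact abs_mul_sub_le hH hf hg hxb (hy hy')

theorem abs_halfConv_le (hH : IsMajorant b H) (hK : IsMajorant b K)
    (hf : ∀ x ∈ Ioo 0 b, |f x| ≤ H x) (hg : ∀ x ∈ Ioo 0 b, |g x| ≤ K x)
    (hfc : ContinuousOn f (Ioi 0)) (hgc : ContinuousOn g (Ioi 0)) (hx : 0 < x) (hxb : x < b) :
    |halfConv f g x| ≤ (∫ y in Ioo 0 b, H y) * K (x / 2) + (∫ y in Ioo 0 b, K y) * H (x / 2) := by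
  rw [halfConv_apply _ _ hx]
  obtain ⟨h1, h2⟩ := hH.intervalIntegrable_mul_sub_and_le hK hx hxb
  refine (intervalIntegral.abs_integral_le_integral_abs hx.le).trans (le_trans ?_ h2)
  exact intervalIntegral.integral_mono_on_of_le_Ioo hx.le
    (intervalIntegrable_mul_sub_of_majorant hH hK hf hg hfc hgc hx hxb).abs h1
    fun y hy => abs_mul_sub_le hH hf hg hxb hy

end Pointwise

/-! ### Families majorized uniformly in ε -/

/-- A family `F ε`, `ε ≥ 0`, of continuous functions on `(0, ∞)` which converges pointwise to `F 0`
as `ε ↓ 0`, and which has on each interval `(0, b)` a majorant independent of `ε`. -/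
structure IsMajorizedFamily (F : ℝ → ℝ → ℝ) : Prop where
  continuousOn : ∀ ε, 0 ≤ ε → ContinuousOn (F ε) (Ioi 0)
  tendsto : ∀ x, 0 < x → Tendsto (fun ε => F ε x) (𝓝[>] 0) (𝓝 (F 0 x))
  exists_majorant : ∀ b, 0 < b → ∃ H, IsMajorant b H ∧
    ∀ ε, 0 ≤ ε → ∀ x ∈ Ioo 0 b, |F ε x| ≤ H x

namespace IsMajorizedFamily

variable {F G : ℝ → ℝ → ℝ}

theorem add (hF : IsMajorizedFamily F) (hG : IsMajorizedFamily G) :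
    IsMajorizedFamily fun ε x => F ε x + G ε x where
  continuousOn ε hε := (hF.continuousOn ε hε).add (hG.continuousOn ε hε)
  tendsto x hx := (hF.tendsto x hx).add (hG.tendsto x hx)
  exists_majorant b hb := by
    obtain ⟨H, hH, hFH⟩ := hF.exists_majorant b hb
    obtain ⟨K, hK, hGK⟩ := hG.exists_majorant b hb
    exact ⟨_, hH.add hK, fun ε hε x hx =>
      (abs_add_le _ _).trans (add_le_add (hFH ε hε x hx) (hGK ε hε x hx))⟩

theorem const_mul (hF : IsMajorizedFamily F) (c : ℝ) :
    IsMajorizedFamily fun ε x => c * F ε x where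
  continuousOn ε hε := continuousOn_const.mul (hF.continuousOn ε hε)
  tendsto x hx := (hF.tendsto x hx).const_mul c
  exists_majorant b hb := by
    obtain ⟨H, hH, hFH⟩ := hF.exists_majorant b hb
    exact ⟨_, hH.const_mul (abs_nonneg c), fun ε hε x hx => by
      rw [abs_mul]; exact mul_le_mul_of_nonneg_left (hFH ε hε x hx) (abs_nonneg c)⟩

theorem intervalIntegrable (hF : IsMajorizedFamily F) (hG : IsMajorizedFamily G) {ε : ℝ}
    (hε : 0 ≤ ε) {x : ℝ} (hx : 0 < x) :
    IntervalIntegrable (fun y => F ε y * G ε (x - y)) volume 0 x := by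
  -- Any right end beyond `x` would do; it leaves room for a neighbourhood of `x` in the later
  -- arguments.
  obtain ⟨H, hH, hFH⟩ := hF.exists_majorant (x + 1) (by linarith)
  obtain ⟨K, hK, hGK⟩ := hG.exists_majorant (x + 1) (by linarith)
  exact intervalIntegrable_mul_sub_of_majorant hH hK (hFH ε hε) (hGK ε hε)
    (hF.continuousOn ε hε) (hG.continuousOn ε hε) hx (lt_add_one x)

theorem halfConv (hF : IsMajorizedFamily F) (hG : IsMajorizedFamily G) :
    IsMajorizedFamily fun ε => halfConv (F ε) (G ε) where
  continuousOn ε hε := by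
    intro x hx
    have hx : 0 < x := hx
    refine ContinuousAt.continuousWithinAt ?_
    obtain ⟨H, hH, hFH⟩ := hF.exists_majorant (x + 1) (by linarith)
    obtain ⟨K, hK, hGK⟩ := hG.exists_majorant (x + 1) (by linarith)
    have hnhds : Ioo (x / 2) (x + 1) ∈ 𝓝 x := Ioo_mem_nhds (by linarith) (by linarith)
    have key : ContinuousAt (fun x => ∫ t in 0..1, F ε (x * t) * G ε (x * (1 - t))) x := by
      refine intervalIntegral.continuousAt_of_dominated_interval ?_ ?_
        (hH.intervalIntegrable_dilate hK (half_pos hx) (by linarith)) ?_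
      · filter_upwards [Ioi_mem_nhds hx] with z hz
        exact aestronglyMeasurable_uIoc_of_continuousOn zero_le_one
          (continuousOn_dilate (hF.continuousOn ε hε) (hG.continuousOn ε hε) hz)
      · filter_upwards [hnhds] with z hz
        filter_upwards [ae_mem_Ioo_of_mem_uIoc zero_le_one] with t ht ht'
        exact abs_dilate_le hH hK (hFH ε hε) (hGK ε hε) (half_pos hx) hz.1.le hz.2 (ht ht')
      · filter_upwards [ae_mem_Ioo_of_mem_uIoc zero_le_one] with t ht ht'
        have h1 := mul_pos hx (ht ht').1
        have h2 := mul_pos hx (sub_pos.2 (ht ht').2)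
        have h3 : ContinuousAt (fun z => z * t) x := by fun_prop
        have h4 : ContinuousAt (fun z => z * (1 - t)) x := by fun_prop
        exact (ContinuousAt.comp (f := fun z => z * t)
          ((hF.continuousOn ε hε).continuousAt (Ioi_mem_nhds h1)) h3).mul
          (ContinuousAt.comp (f := fun z => z * (1 - t))
          ((hG.continuousOn ε hε).continuousAt (Ioi_mem_nhds h2)) h4)
    refine (continuousAt_id.mul key).congr ?_
    filter_upwards [Ioi_mem_nhds hx] with z hz
    exact (halfConv_dilate _ _ hz).symm
  tendsto x hx := by
    simp only [halfConv_apply _ _ hx]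
    obtain ⟨H, hH, hFH⟩ := hF.exists_majorant (x + 1) (by linarith)
    obtain ⟨K, hK, hGK⟩ := hG.exists_majorant (x + 1) (by linarith)
    refine intervalIntegral.tendsto_integral_filter_of_dominated_convergence _ ?_ ?_
      (hH.intervalIntegrable_mul_sub hK hx (lt_add_one x)) ?_
    · filter_upwards [self_mem_nhdsWithin] with ε hε
      exact aestronglyMeasurable_uIoc_of_continuousOn hx.le
        (continuousOn_mul_sub (hF.continuousOn ε (le_of_lt hε)) (hG.continuousOn ε (le_of_lt hε)))
    · filter_upwards [self_mem_nhdsWithin] with ε hε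
      filter_upwards [ae_mem_Ioo_of_mem_uIoc hx.le] with y hy hy'
      exact abs_mul_sub_le hH (hFH ε (le_of_lt hε)) (hGK ε (le_of_lt hε)) (lt_add_one x) (hy hy')
    · filter_upwards [ae_mem_Ioo_of_mem_uIoc hx.le] with y hy hy'
      exact (hF.tendsto y (hy hy').1).mul (hG.tendsto (x - y) (sub_pos.2 (hy hy').2))
  exists_majorant b hb := by
    obtain ⟨H, hH, hFH⟩ := hF.exists_majorant b hb
    obtain ⟨K, hK, hGK⟩ := hG.exists_majorant b hb
    have hI : ∀ {H : ℝ → ℝ}, IsMajorant b H → 0 ≤ ∫ y in Ioo 0 b, H y := fun h =>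
      setIntegral_nonneg measurableSet_Ioo h.nonneg
    exact ⟨_, (hK.comp_half.const_mul (hI hH)).add (hH.comp_half.const_mul (hI hK)),
      fun ε hε x hx => abs_halfConv_le hH hK (hFH ε hε) (hGK ε hε) (hF.continuousOn ε hε)
        (hG.continuousOn ε hε) hx.1 hx.2⟩

/-- Here `F'` and `G'` stand for θF and θG with θ = x d/dx, and the formula is θ(F * G) = F * G + θF
* G + F * θG. The first term comes from the factor `x` in `halfConv_dilate`, the others from
differentiating under the integral. -/
theorem hasDerivAt_halfConv {F' G' : ℝ → ℝ → ℝ} (hF : IsMajorizedFamily F)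
    (hG : IsMajorizedFamily G) (hF' : IsMajorizedFamily F') (hG' : IsMajorizedFamily G') {ε : ℝ}
    (hε : 0 ≤ ε) (hFd : ∀ x, 0 < x → HasDerivAt (F ε) (F' ε x / x) x)
    (hGd : ∀ x, 0 < x → HasDerivAt (G ε) (G' ε x / x) x) {x : ℝ} (hx : 0 < x) :
    HasDerivAt (_root_.halfConv (F ε) (G ε))
      ((_root_.halfConv (F ε) (G ε) x + (_root_.halfConv (F' ε) (G ε) x +
        _root_.halfConv (F ε) (G' ε) x)) / x) x := by
  obtain ⟨H, hH, hFH⟩ := hF.exists_majorant (x + 1) (by linarith)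
  obtain ⟨K, hK, hGK⟩ := hG.exists_majorant (x + 1) (by linarith)
  obtain ⟨H', hH', hFH'⟩ := hF'.exists_majorant (x + 1) (by linarith)
  obtain ⟨K', hK', hGK'⟩ := hG'.exists_majorant (x + 1) (by linarith)
  have hnhds : Ioo (x / 2) (x + 1) ∈ 𝓝 x := Ioo_mem_nhds (by linarith) (by linarith)
  have hx2 := half_pos hx
  have hx2' : x / 2 < x + 1 := by linarith
  have hc := hF.continuousOn ε hε
  have hc' := hF'.continuousOn ε hε
  have hd := hG.continuousOn ε hε
  have hd' := hG'.continuousOn ε hε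
  have hdil : ∀ {f g H K : ℝ → ℝ}, ContinuousOn f (Ioi 0) → ContinuousOn g (Ioi 0) →
      IsMajorant (x + 1) H → IsMajorant (x + 1) K → (∀ y ∈ Ioo 0 (x + 1), |f y| ≤ H y) →
      (∀ y ∈ Ioo 0 (x + 1), |g y| ≤ K y) →
      IntervalIntegrable (fun t => f (x * t) * g (x * (1 - t))) volume 0 1 := by
    intro f g H K hf hg hH hK hfH hgK
    refine (hH.intervalIntegrable_dilate hK hx (lt_add_one x)).mono_fun'
      (aestronglyMeasurable_uIoc_of_continuousOn zero_le_one (continuousOn_dilate hf hg hx)) ?_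
    refine (ae_restrict_iff' measurableSet_uIoc).2 ?_
    filter_upwards [ae_mem_Ioo_of_mem_uIoc zero_le_one] with t ht ht'
    exact abs_dilate_le hH hK hfH hgK hx le_rfl (lt_add_one x) (ht ht')
  have key := (intervalIntegral.hasDerivAt_integral_of_dominated_loc_of_deriv_le
    (μ := volume) (a := 0) (b := 1)
    (F := fun x t => F ε (x * t) * G ε (x * (1 - t)))
    (F' := fun x t => x⁻¹ * (F' ε (x * t) * G ε (x * (1 - t)) + F ε (x * t) * G' ε (x * (1 - t))))
    (bound := fun t => (x / 2)⁻¹ * (H' (x / 2 * t) * K (x / 2 * (1 - t)) +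
      H (x / 2 * t) * K' (x / 2 * (1 - t)))) hnhds ?_ ?_ ?_ ?_ ?_ ?_).2
  · have hmul := (hasDerivAt_id x).mul key
    have heq : _root_.halfConv (F ε) (G ε) =ᶠ[𝓝 x]
        (id * fun x => ∫ t in 0..1, F ε (x * t) * G ε (x * (1 - t))) := by
      filter_upwards [Ioi_mem_nhds hx] with z hz
      exact halfConv_dilate _ _ hz
    refine (hmul.congr_of_eventuallyEq heq).congr_deriv ?_
    rw [intervalIntegral.integral_const_mul, intervalIntegral.integral_add
      (hdil hc' hd hH' hK (hFH' ε hε) (hGK ε hε)) (hdil hc hd' hH hK' (hFH ε hε) (hGK' ε hε)),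
      halfConv_dilate _ _ hx, halfConv_dilate _ _ hx, halfConv_dilate _ _ hx]
    simp only [id]
    field_simp
  · filter_upwards [Ioi_mem_nhds hx] with z hz
    exact aestronglyMeasurable_uIoc_of_continuousOn zero_le_one (continuousOn_dilate hc hd hz)
  · exact hdil hc hd hH hK (hFH ε hε) (hGK ε hε)
  · exact aestronglyMeasurable_uIoc_of_continuousOn zero_le_one
      (continuousOn_const.mul ((continuousOn_dilate hc' hd hx).add (continuousOn_dilate hc hd' hx)))
  · filter_upwards [ae_mem_Ioo_of_mem_uIoc zero_le_one] with t ht ht' z hz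
    have hz0 : 0 < z := hx2.trans hz.1
    rw [Real.norm_eq_abs, abs_mul, abs_of_pos (inv_pos.2 hz0)]
    refine mul_le_mul (inv_anti₀ hx2 hz.1.le) ((abs_add_le _ _).trans (add_le_add ?_ ?_))
      (abs_nonneg _) (inv_pos.2 hx2).le
    · exact abs_dilate_le hH' hK (hFH' ε hε) (hGK ε hε) hx2 hz.1.le hz.2 (ht ht')
    · exact abs_dilate_le hH hK' (hFH ε hε) (hGK' ε hε) hx2 hz.1.le hz.2 (ht ht')
  · exact ((hH'.intervalIntegrable_dilate hK hx2 hx2').add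
      (hH.intervalIntegrable_dilate hK' hx2 hx2')).const_mul _
  · filter_upwards [ae_mem_Ioo_of_mem_uIoc zero_le_one] with t ht ht' z hz
    have hz0 : 0 < z := hx2.trans hz.1
    have ht1 := (ht ht').1
    have ht2 := sub_pos.2 (ht ht').2
    have h1 := (hFd _ (mul_pos hz0 ht1)).comp z ((hasDerivAt_id z).mul_const t)
    have h2 := (hGd _ (mul_pos hz0 ht2)).comp z ((hasDerivAt_id z).mul_const (1 - t))
    refine (h1.mul h2).congr_deriv ?_
    simp only [Function.comp, id]
    field_simp

end IsMajorizedFamily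

/-! ### Iterates of the Euler operator -/

/-- A majorized family whose iterates under the Euler operator `x d/dx`, up to order `k`, are
majorized families. -/
def IsMajorizedFamilyOfOrder : ℕ → (ℝ → ℝ → ℝ) → Prop
  | 0, F => IsMajorizedFamily F
  | k + 1, F => IsMajorizedFamily F ∧ ∃ G, IsMajorizedFamilyOfOrder k G ∧
      ∀ ε, 0 ≤ ε → ∀ x, 0 < x → HasDerivAt (F ε) (G ε x / x) x

namespace IsMajorizedFamilyOfOrder

theorem isMajorizedFamily : ∀ {k : ℕ} {F : ℝ → ℝ → ℝ}, IsMajorizedFamilyOfOrder k F →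
    IsMajorizedFamily F
  | 0, _, h => h
  | _ + 1, _, h => h.1

theorem of_succ : ∀ {k : ℕ} {F : ℝ → ℝ → ℝ}, IsMajorizedFamilyOfOrder (k + 1) F →
    IsMajorizedFamilyOfOrder k F
  | 0, _, h => h.1
  | _ + 1, _, ⟨h, G, hG, hd⟩ => ⟨h, G, hG.of_succ, hd⟩

theorem add : ∀ {k : ℕ} {F G : ℝ → ℝ → ℝ}, IsMajorizedFamilyOfOrder k F →
    IsMajorizedFamilyOfOrder k G → IsMajorizedFamilyOfOrder k fun ε x => F ε x + G ε x
  | 0, _, _, hF, hG => IsMajorizedFamily.add hF hG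
  | _ + 1, _, _, ⟨hF, F', hF', hFd⟩, ⟨hG, G', hG', hGd⟩ =>
    ⟨hF.add hG, _, hF'.add hG', fun ε hε x hx => by
      rw [add_div]; exact (hFd ε hε x hx).add (hGd ε hε x hx)⟩

theorem const_mul : ∀ {k : ℕ} {F : ℝ → ℝ → ℝ}, IsMajorizedFamilyOfOrder k F → ∀ c : ℝ,
    IsMajorizedFamilyOfOrder k fun ε x => c * F ε x
  | 0, _, hF, c => IsMajorizedFamily.const_mul hF c
  | _ + 1, _, ⟨hF, F', hF', hFd⟩, c =>
    ⟨hF.const_mul c, _, hF'.const_mul c, fun ε hε x hx => by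
      rw [mul_div_assoc]; exact (hFd ε hε x hx).const_mul c⟩

theorem halfConv : ∀ {k : ℕ} {F G : ℝ → ℝ → ℝ}, IsMajorizedFamilyOfOrder k F →
    IsMajorizedFamilyOfOrder k G → IsMajorizedFamilyOfOrder k fun ε => halfConv (F ε) (G ε)
  | 0, _, _, hF, hG => IsMajorizedFamily.halfConv hF hG
  | _ + 1, _, _, hF, hG => by
    -- The Euler image of the convolution contains undifferentiated factors, which are needed only
    -- to the lower order `k`.
    have hF0 := hF.of_succ
    have hG0 := hG.of_succ
    obtain ⟨hF, F', hF', hFd⟩ := hF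
    obtain ⟨hG, G', hG', hGd⟩ := hG
    exact ⟨hF.halfConv hG, _, (hF0.halfConv hG0).add ((hF'.halfConv hG0).add (hF0.halfConv hG')),
      fun ε hε x hx => hF.hasDerivAt_halfConv hG hF'.isMajorizedFamily hG'.isMajorizedFamily hε
        (hFd ε hε) (hGd ε hε) hx⟩

theorem convPow {k : ℕ} {F : ℝ → ℝ → ℝ} (hF : IsMajorizedFamilyOfOrder k F) :
    ∀ {n : ℕ}, 1 ≤ n → IsMajorizedFamilyOfOrder k fun ε => convPow (F ε) n
  | 1, _ => hF
  | n + 2, _ => (hF.convPow (n := n + 1) (by omega)).halfConv hF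

/-- The power `p` makes the induction close: with θ = x d/dx, the derivative of F / x^p is (θF - pF)
/ x^{p+1}, a quotient of the same shape with one order less. The case `p = 0` is the one used
afterwards. -/
theorem contDiffOn_div_pow_and_tendsto {k : ℕ} {F : ℝ → ℝ → ℝ}
    (hF : IsMajorizedFamilyOfOrder k F) (p : ℕ) :
    (∀ ε, 0 ≤ ε → ContDiffOn ℝ k (fun x => F ε x / x ^ p) (Ioi 0)) ∧
      ∀ x, 0 < x → Tendsto (fun ε => iteratedDeriv k (fun x => F ε x / x ^ p) x) (𝓝[>] 0)
        (𝓝 (iteratedDeriv k (fun x => F 0 x / x ^ p) x)) := by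
  induction k generalizing F p with
  | zero =>
    have hF : IsMajorizedFamily F := hF
    refine ⟨fun ε hε => ?_, fun x hx => ?_⟩
    · simp only [Nat.cast_zero, contDiffOn_zero]
      exact (hF.continuousOn ε hε).div (by fun_prop) fun x hx => pow_ne_zero _ (ne_of_gt hx)
    · simp only [iteratedDeriv_zero]
      exact (hF.tendsto x hx).div_const _
  | succ k ih =>
    have hF0 := hF.of_succ
    obtain ⟨hF, G, hG, hd⟩ := hF
    obtain ⟨ih1, ih2⟩ := ih (hG.add (hF0.const_mul (-p))) (p + 1)
    have hder : ∀ ε, 0 ≤ ε → ∀ x, 0 < x → HasDerivAt (fun x => F ε x / x ^ p)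
        ((G ε x + -(p : ℝ) * F ε x) / x ^ (p + 1)) x := by
      intro ε hε x hx
      refine ((hd ε hε x hx).div (hasDerivAt_pow p x) (pow_ne_zero _ hx.ne')).congr_deriv ?_
      rcases p with _ | p
      · simp
      · simp only [Nat.add_sub_cancel]
        field_simp
        push_cast
        ring
    have hderiv : ∀ ε, 0 ≤ ε → EqOn (deriv fun x => F ε x / x ^ p)
        (fun x => (G ε x + -(p : ℝ) * F ε x) / x ^ (p + 1)) (Ioi 0) :=
      fun ε hε x hx => (hder ε hε x hx).deriv
    have hiter : ∀ ε, 0 ≤ ε → ∀ x, 0 < x → iteratedDeriv (k + 1) (fun x => F ε x / x ^ p) x =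
        iteratedDeriv k (fun x => (G ε x + -(p : ℝ) * F ε x) / x ^ (p + 1)) x := by
      intro ε hε x hx
      rw [iteratedDeriv_succ']
      exact ((hderiv ε hε).eventuallyEq_of_mem (Ioi_mem_nhds hx)).iteratedDeriv_eq k
    refine ⟨fun ε hε => ?_, fun x hx => ?_⟩
    · push_cast
      rw [contDiffOn_succ_iff_deriv_of_isOpen isOpen_Ioi]
      refine ⟨fun x hx => (hder ε hε x hx).differentiableAt.differentiableWithinAt, by simp, ?_⟩
      exact (ih1 ε hε).congr (hderiv ε hε)
    · rw [hiter 0 le_rfl x hx]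
      refine (ih2 x hx).congr' ?_
      filter_upwards [self_mem_nhdsWithin] with ε hε
      exact (hiter ε (le_of_lt hε) x hx).symm

theorem contDiffOn {k : ℕ} {F : ℝ → ℝ → ℝ} (hF : IsMajorizedFamilyOfOrder k F) {ε : ℝ}
    (hε : 0 ≤ ε) : ContDiffOn ℝ k (F ε) (Ioi 0) := by
  simpa using (hF.contDiffOn_div_pow_and_tendsto 0).1 ε hε

theorem tendsto_iteratedDeriv {k : ℕ} {F : ℝ → ℝ → ℝ} (hF : IsMajorizedFamilyOfOrder k F)
    {x : ℝ} (hx : 0 < x) :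
    Tendsto (fun ε => iteratedDeriv k (F ε) x) (𝓝[>] 0) (𝓝 (iteratedDeriv k (F 0) x)) := by
  simpa using (hF.contDiffOn_div_pow_and_tendsto 0).2 x hx

end IsMajorizedFamilyOfOrder

/-! ### Tail integrals as majorants -/

namespace IsSubordinatorLevyDensity

variable {w : ℝ → ℝ}

theorem aestronglyMeasurable (hw : IsSubordinatorLevyDensity w) :
    AEStronglyMeasurable w (volume.restrict (Ioi 0)) := by
  have h1 : AEStronglyMeasurable (fun x : ℝ => (min 1 x)⁻¹ * (min 1 x * w x))
      (volume.restrict (Ioi 0)) :=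
    ((measurable_const.min measurable_id).inv.aestronglyMeasurable).mul
      hw.integrable_min.aestronglyMeasurable
  refine h1.congr ?_
  filter_upwards [ae_restrict_mem measurableSet_Ioi] with x hx
  exact inv_mul_cancel_left₀ (lt_min one_pos hx).ne' _

theorem integrableOn_Ioi (hw : IsSubordinatorLevyDensity w) {x : ℝ} (hx : 0 < x) :
    IntegrableOn w (Ioi x) := by
  have hsub : Ioi x ⊆ Ioi 0 := Ioi_subset_Ioi hx.le
  have hmin : 0 < min 1 x := lt_min one_pos hx
  refine Integrable.mono' ((hw.integrable_min.mono_set hsub).const_mul (min 1 x)⁻¹)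
    (hw.aestronglyMeasurable.mono_measure (Measure.restrict_mono hsub le_rfl)) ?_
  filter_upwards [ae_restrict_mem measurableSet_Ioi] with y hy
  have hy0 : 0 < y := hx.trans hy
  rw [Real.norm_of_nonneg (hw.nonneg y hy0), ← mul_assoc]
  refine le_mul_of_one_le_left (hw.nonneg y hy0) ?_
  rw [← div_eq_inv_mul, one_le_div hmin]
  exact min_le_min le_rfl (le_of_lt hy)

/-- Integrability is Fubini for w(y) on the region x < y: the integral of the tail over (0, b)
equals ∫ min(y, b) w(y) dy, and min(y, b) ≤ max(1, b) min(1, y). -/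
theorem isMajorant_tailIntegral (hw : IsSubordinatorLevyDensity w) (b : ℝ) :
    IsMajorant b (tailIntegral w) where
  antitoneOn x hx y hy hxy := by
    refine setIntegral_mono_set (hw.integrableOn_Ioi hx.1) ?_
      (LE.le.eventuallyLE (Ioi_subset_Ioi hxy))
    filter_upwards [ae_restrict_mem measurableSet_Ioi] with z hz using hw.nonneg z (hx.1.trans hz)
  nonneg x hx := setIntegral_nonneg measurableSet_Ioi fun z hz => hw.nonneg z (hx.1.trans hz)
  integrableOn := by
    let f : ℝ × ℝ → ℝ := fun p => {q : ℝ × ℝ | q.2 < q.1}.indicator (fun q => w q.1) p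
    have hs : MeasurableSet {q : ℝ × ℝ | q.2 < q.1} := measurableSet_lt measurable_snd measurable_fst
    have hf : AEStronglyMeasurable f
        ((volume.restrict (Ioi 0)).prod (volume.restrict (Ioo 0 b))) :=
      hw.aestronglyMeasurable.comp_fst.indicator hs
    have hval : ∀ y x, f (y, x) = (Iio y).indicator (fun _ => w y) x := fun y x => rfl
    have hint : Integrable f ((volume.restrict (Ioi 0)).prod (volume.restrict (Ioo 0 b))) := by
      rw [integrable_prod_iff hf]
      refine ⟨Eventually.of_forall fun y => ?_, ?_⟩
      · simp only [hval]
        exact (integrableOn_const (by simp)).indicator measurableSet_Iio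
      · refine Integrable.mono' (hw.integrable_min.const_mul (max 1 b))
          hf.norm.integral_prod_right' ?_
        filter_upwards [ae_restrict_mem measurableSet_Ioi] with y hy
        have hy : 0 < y := hy
        have hwy := hw.nonneg y hy
        simp only [hval, norm_indicator_eq_indicator_norm]
        rw [integral_indicator measurableSet_Iio, Measure.restrict_restrict measurableSet_Iio,
          setIntegral_const, Real.norm_of_nonneg hwy, smul_eq_mul,
          Real.norm_of_nonneg (mul_nonneg measureReal_nonneg hwy), ← mul_assoc]
        refine mul_le_mul_of_nonneg_right ?_ hwy
        have h1 : volume.real (Iio y ∩ Ioo 0 b) ≤ y := by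
          calc volume.real (Iio y ∩ Ioo 0 b) ≤ volume.real (Ioo 0 y) :=
                measureReal_mono (fun z hz => ⟨hz.2.1, hz.1⟩) (by simp)
            _ = y := by simp [hy.le]
        have h2 : volume.real (Iio y ∩ Ioo 0 b) ≤ max 1 b := by
          calc volume.real (Iio y ∩ Ioo 0 b) ≤ volume.real (Ioo 0 (max 1 b)) :=
                measureReal_mono (fun z hz => ⟨hz.2.1, hz.2.2.trans_le (le_max_right _ _)⟩) (by simp)
            _ = max 1 b := by simp
        rcases le_total 1 y with h | h
        · rw [min_eq_left h, mul_one]; exact h2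
        · rw [min_eq_right h]
          exact h1.trans (le_mul_of_one_le_left hy.le (le_max_left _ _))
    refine hint.integral_prod_right.congr ?_
    filter_upwards [ae_restrict_mem measurableSet_Ioo] with x hx
    have : ∀ y, f (y, x) = (Ioi x).indicator w y := fun y => rfl
    simp only [this]
    rw [integral_indicator measurableSet_Ioi, Measure.restrict_restrict measurableSet_Ioi,
      inter_eq_left.2 (Ioi_subset_Ioi hx.1.le), tailIntegral]

theorem hasDerivAt_tailIntegral (hw : IsSubordinatorLevyDensity w) (hc : ContinuousOn w (Ioi 0))
    {x : ℝ} (hx : 0 < x) : HasDerivAt (tailIntegral w) (-w x) x := by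
  have hx2 := half_pos hx
  have hsm : StronglyMeasurableAtFilter w (𝓝 x) :=
    hc.stronglyMeasurableAtFilter isOpen_Ioi x hx
  have hii : ∀ y, 0 < y → IntervalIntegrable w volume (x / 2) y := fun y hy =>
    (hc.mono fun z hz => (lt_min hx2 hy).trans_le hz.1).intervalIntegrable
  have h := (intervalIntegral.integral_hasDerivAt_right (hii x hx) hsm
    (hc.continuousAt (Ioi_mem_nhds hx))).const_sub (tailIntegral w (x / 2))
  refine h.congr_of_eventuallyEq ?_
  filter_upwards [Ioi_mem_nhds hx] with y hy
  rw [tailIntegral, tailIntegral, ← intervalIntegral.integral_Ioi_sub_Ioi'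
    (hw.integrableOn_Ioi hx2) (hw.integrableOn_Ioi hy)]
  ring

end IsSubordinatorLevyDensity

/-- By the fundamental theorem, |h(x)| ≤ |h(b)| + ∫_x^b |h'|. The last integral is the tail of |h'|
cut off to (0, b], itself a subordinator Lévy density because x h'(x) is integrable there. -/
theorem exists_majorant_of_hasDerivAt {h h' : ℝ → ℝ} (hd : ∀ x, 0 < x → HasDerivAt h (h' x) x)
    (hc : ContinuousOn h' (Ioi 0)) {b : ℝ} (hi : IntegrableOn (fun x => x * h' x) (Ioc 0 b)) :
    ∃ H, IsMajorant b H ∧ ∀ x ∈ Ioo 0 b, |h x| ≤ H x := by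
  have hw : IsSubordinatorLevyDensity ((Ioc 0 b).indicator fun x => |h' x|) := by
    refine ⟨fun x _ => indicator_nonneg (fun _ _ => abs_nonneg _) x, ?_⟩
    have h1 : IntegrableOn (fun x : ℝ => min 1 x * |h' x|) (Ioc 0 b) := by
      refine Integrable.mono hi ?_ ?_
      · exact ((continuous_const.min continuous_id).continuousOn.mul
          (hc.abs.mono fun x hx => hx.1)).aestronglyMeasurable measurableSet_Ioc
      · filter_upwards [ae_restrict_mem measurableSet_Ioc] with x hx
        rw [norm_mul, norm_mul, Real.norm_of_nonneg (le_min zero_le_one hx.1.le),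
          Real.norm_of_nonneg hx.1.le, norm_abs_eq_norm]
        exact mul_le_mul_of_nonneg_right (min_le_right _ _) (norm_nonneg _)
    have h2 := (integrable_indicator_iff measurableSet_Ioc).2 h1
    refine h2.integrableOn.congr (Eventually.of_forall fun x => ?_)
    by_cases hx : x ∈ Ioc 0 b <;> simp [hx]
  refine ⟨_, (IsMajorant.const (abs_nonneg (h b))).add (hw.isMajorant_tailIntegral b),
    fun x hx => ?_⟩
  have hcx : ContinuousOn h' (uIcc x b) :=
    hc.mono fun z hz => (lt_min hx.1 (hx.1.trans hx.2)).trans_le hz.1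
  have hftc := intervalIntegral.integral_eq_sub_of_hasDerivAt (a := x) (b := b)
    (fun z hz => hd z ((lt_min hx.1 (hx.1.trans hx.2)).trans_le hz.1)) hcx.intervalIntegrable
  have htail : tailIntegral ((Ioc 0 b).indicator fun x => |h' x|) x = ∫ y in x..b, |h' y| := by
    rw [tailIntegral, setIntegral_indicator measurableSet_Ioc,
      intervalIntegral.integral_of_le hx.2.le]
    congr 2
    ext z
    exact ⟨fun hz => ⟨hz.1, hz.2.2⟩, fun hz => ⟨hz.1, hx.1.trans hz.1, hz.2⟩⟩
  have habs := intervalIntegral.abs_integral_le_integral_abs (f := h') (μ := volume) hx.2.le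
  rw [hftc] at habs
  rw [htail]
  calc |h x| = |h b - (h b - h x)| := by rw [sub_sub_cancel]
    _ ≤ |h b| + |h b - h x| := abs_sub _ _
    _ ≤ _ := by gcongr

/-! ### Euler iterates of x u_ε(x) -/

section IteratedDeriv

variable {u : ℝ → ℝ} {m : ℕ}

theorem ContDiffOn.hasDerivAt_iteratedDeriv {s : Set ℝ} (hs : IsOpen s)
    (hu : ContDiffOn ℝ m u s) {j : ℕ} (hj : j < m) {x : ℝ} (hx : x ∈ s) :
    HasDerivAt (iteratedDeriv j u) (iteratedDeriv (j + 1) u x) x := by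
  have h1 := hu.differentiableOn_iteratedDerivWithin (m := j) (mod_cast hj) hs.uniqueDiffOn
  have h2 := (h1.congr fun y hy => (iteratedDerivWithin_of_isOpen hs hy).symm).differentiableAt
    (hs.mem_nhds hx)
  rw [iteratedDeriv_succ]
  exact h2.hasDerivAt

theorem ContDiffOn.continuousOn_iteratedDeriv {s : Set ℝ} (hs : IsOpen s)
    (hu : ContDiffOn ℝ m u s) {j : ℕ} (hj : j ≤ m) : ContinuousOn (iteratedDeriv j u) s :=
  (hu.continuousOn_iteratedDerivWithin (m := j) (mod_cast hj) hs.uniqueDiffOn).congr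
    fun _ hy => (iteratedDerivWithin_of_isOpen hs hy).symm

end IteratedDeriv

/-- One term of the exponential series is at most its sum. With `y = ε / x` this bounds the
prefactor of `eulerTerm` uniformly in `ε` and `x`. -/
theorem abs_pow_mul_exp_neg_le {y : ℝ} (hy : 0 ≤ y) (i : ℕ) :
    |y ^ i * Real.exp (-y)| ≤ i.factorial := by
  have h := Real.pow_div_factorial_le_exp y hy i
  rw [abs_of_nonneg (by positivity), Real.exp_neg, ← div_eq_mul_inv, div_le_iff₀ (Real.exp_pos _)]
  rwa [div_le_iff₀' (by positivity)] at h

/-- The terms produced from `x * u_ε(x)` by the Euler operator `x d/dx`. -/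
noncomputable def eulerTerm (u : ℝ → ℝ) (i j : ℕ) (ε x : ℝ) : ℝ :=
  (ε / x) ^ i * Real.exp (-(ε / x)) * (x ^ (j + 1) * iteratedDeriv j u x)

section Family

variable {u : ℝ → ℝ} {m : ℕ}
  (hsmooth : ContDiffOn ℝ m u (Ioi 0))
  (hint : ∀ k : ℕ, k ≤ m → ∀ b : ℝ,
    IntegrableOn (fun x : ℝ => x ^ (k + 1) * iteratedDeriv k u x) (Ioc 0 b))

include hsmooth hint

/-- The majorant is `i!` times one for x^{j+1} u^{(j)}, obtained from its derivative; this is why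
one derivative beyond `j` is required. -/
theorem isMajorizedFamily_eulerTerm (i : ℕ) {j : ℕ} (hj : j + 1 ≤ m) :
    IsMajorizedFamily (eulerTerm u i j) where
  continuousOn ε _ := by
    have h1 : ContinuousOn (fun x : ℝ => ε / x) (Ioi 0) :=
      continuousOn_const.div continuousOn_id fun x hx => ne_of_gt hx
    exact ((h1.pow i).mul (h1.neg.rexp)).mul ((continuousOn_id.pow _).mul
      (hsmooth.continuousOn_iteratedDeriv isOpen_Ioi (by omega)))
  tendsto x _ := by
    -- For fixed `x` the term is continuous in `ε` through `0`; the limit vanishes when `i > 0`.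
    have h1 : Continuous fun ε => eulerTerm u i j ε x := by
      unfold eulerTerm
      fun_prop
    exact (h1.tendsto 0).mono_left nhdsWithin_le_nhds
  exists_majorant b _ := by
    have hd : ∀ x, 0 < x → HasDerivAt (fun x => x ^ (j + 1) * iteratedDeriv j u x)
        (((j + 1 : ℕ) : ℝ) * x ^ j * iteratedDeriv j u x +
          x ^ (j + 1) * iteratedDeriv (j + 1) u x) x := fun x hx =>
      (hasDerivAt_pow (j + 1) x).mul
        (hsmooth.hasDerivAt_iteratedDeriv isOpen_Ioi (by omega) hx)
    have hc := (((continuousOn_const (c := ((j + 1 : ℕ) : ℝ))).mul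
      (continuousOn_id.pow j)).mul (hsmooth.continuousOn_iteratedDeriv isOpen_Ioi
        (by omega : j ≤ m))).add ((continuousOn_id.pow (j + 1)).mul
      (hsmooth.continuousOn_iteratedDeriv isOpen_Ioi hj))
    obtain ⟨H, hH, hle⟩ := exists_majorant_of_hasDerivAt (b := b) hd hc (by
      refine (((hint j (by omega) b).const_mul ((j + 1 : ℕ) : ℝ)).add (hint (j + 1) hj b)).congr
        (Eventually.of_forall fun x => ?_)
      simp only [Pi.add_apply]
      ring)
    refine ⟨_, hH.const_mul (Nat.cast_nonneg i.factorial), fun ε hε x hx => ?_⟩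
    rw [eulerTerm, abs_mul]
    exact mul_le_mul (abs_pow_mul_exp_neg_le (div_nonneg hε hx.1.le) i) (hle x hx) (abs_nonneg _)
      (Nat.cast_nonneg _)

omit hint in
-- The span of these terms is stable under x d/dx: the powers (ε/x)^i and x^{j+1} contribute -i and
-- j + 1, the exponential contributes a factor ε/x, and differentiating u^{(j)} raises `j`.
theorem hasDerivAt_eulerTerm (i : ℕ) {j : ℕ} (hj : j < m) (ε : ℝ) {x : ℝ} (hx : 0 < x) :
    HasDerivAt (eulerTerm u i j ε)
      ((((j + 1 : ℝ) - i) * eulerTerm u i j ε x +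
        (eulerTerm u (i + 1) j ε x + eulerTerm u i (j + 1) ε x)) / x) x := by
  have h1 : HasDerivAt (fun x : ℝ => ε / x) (-(ε / x) / x) x := by
    refine ((hasDerivAt_const x ε).div (hasDerivAt_id' x) hx.ne').congr_deriv ?_
    field_simp
    ring
  have h2 := ((h1.pow i).mul h1.neg.exp).mul ((hasDerivAt_pow (j + 1) x).mul
    (hsmooth.hasDerivAt_iteratedDeriv isOpen_Ioi hj hx))
  refine h2.congr_deriv ?_
  simp only [eulerTerm, Nat.add_sub_cancel, Pi.neg_apply, Pi.pow_apply, Pi.mul_apply]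
  generalize ε / x = q
  rcases i with _ | i
  · push_cast
    field_simp
    ring
  · simp only [Nat.add_sub_cancel]
    push_cast
    field_simp
    ring

/-- In `k` steps the index `j` rises to at most `j + k`, and majorizing that term costs one further
derivative. -/
theorem isMajorizedFamilyOfOrder_eulerTerm (k : ℕ) : ∀ (i : ℕ) {j : ℕ}, k + j + 1 ≤ m →
    IsMajorizedFamilyOfOrder k (eulerTerm u i j) := by
  induction k with
  | zero => exact fun i j hj => isMajorizedFamily_eulerTerm hsmooth hint i (by omega)
  | succ k ih =>
    exact fun i j hj => ⟨isMajorizedFamily_eulerTerm hsmooth hint i (by omega), _,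
      ((ih i (by omega)).const_mul _).add ((ih (i + 1) (by omega)).add (ih i (by omega))),
      fun ε _ x hx => hasDerivAt_eulerTerm hsmooth i (by omega) ε hx⟩

end Family

/-! ### The approximations u_ε and their tails -/

section Approximation

variable {u : ℝ → ℝ}

theorem uEps_zero (u : ℝ → ℝ) : uEps u 0 = u := by
  ext x
  simp [uEps]

theorem uEps_nonneg (hu : IsSubordinatorLevyDensity u) (ε : ℝ) {x : ℝ} (hx : 0 < x) :
    0 ≤ uEps u ε x :=
  mul_nonneg (Real.exp_nonneg _) (hu.nonneg x hx)

theorem uEps_le (hu : IsSubordinatorLevyDensity u) {ε : ℝ} (hε : 0 ≤ ε) {x : ℝ} (hx : 0 < x) :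
    uEps u ε x ≤ u x := by
  refine mul_le_of_le_one_left (hu.nonneg x hx) (Real.exp_le_one_iff.2 ?_)
  rw [neg_div]
  exact neg_nonpos.2 (div_nonneg hε hx.le)

theorem measurable_exp_neg_div (ε : ℝ) : Measurable fun x : ℝ => Real.exp (-ε / x) :=
  (measurable_const.div measurable_id).exp

theorem IsSubordinatorLevyDensity.uEps (hu : IsSubordinatorLevyDensity u) {ε : ℝ} (hε : 0 ≤ ε) :
    IsSubordinatorLevyDensity (uEps u ε) := by
  refine ⟨fun x hx => uEps_nonneg hu ε hx, ?_⟩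
  refine Integrable.mono' hu.integrable_min
    ((measurable_const.min measurable_id).aestronglyMeasurable.mul
      ((measurable_exp_neg_div ε).aestronglyMeasurable.mul hu.aestronglyMeasurable)) ?_
  filter_upwards [ae_restrict_mem measurableSet_Ioi] with x hx
  have hm : 0 ≤ min 1 x := le_min zero_le_one (le_of_lt hx)
  rw [Real.norm_of_nonneg (mul_nonneg hm (uEps_nonneg hu ε hx))]
  exact mul_le_mul_of_nonneg_left (uEps_le hu hε hx) hm

theorem IsSubordinatorLevyDensity.integrableOn_uEps (hu : IsSubordinatorLevyDensity u) {ε : ℝ}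
    (hε : 0 < ε) : IntegrableOn (_root_.uEps u ε) (Ioi 0) := by
  refine Integrable.mono' (hu.integrable_min.const_mul (max 1 ε⁻¹))
    ((measurable_exp_neg_div ε).aestronglyMeasurable.mul hu.aestronglyMeasurable) ?_
  filter_upwards [ae_restrict_mem measurableSet_Ioi] with x hx
  have hx : 0 < x := hx
  rw [Real.norm_of_nonneg (uEps_nonneg hu ε hx), _root_.uEps, ← mul_assoc]
  refine mul_le_mul_of_nonneg_right ?_ (hu.nonneg x hx)
  rcases le_total 1 x with h | h
  · rw [min_eq_left h, mul_one]
    refine le_trans (Real.exp_le_one_iff.2 ?_) (le_max_left _ _)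
    rw [neg_div]
    exact neg_nonpos.2 (div_nonneg hε.le hx.le)
  · rw [min_eq_right h]
    refine le_trans ?_ (mul_le_mul_of_nonneg_right (le_max_right _ _) hx.le)
    -- Near 0, the inequality y e^{-y} ≤ 1 at y = ε/x gives e^{-ε/x} ≤ x/ε, which compensates the
    -- singularity of `u`.
    have h1 := abs_pow_mul_exp_neg_le (div_nonneg hε.le hx.le) 1
    have h2 : 0 < ε / x := div_pos hε hx
    rw [abs_of_nonneg (by positivity), pow_one, Nat.factorial_one, Nat.cast_one] at h1
    rw [neg_div, ← div_eq_inv_mul, ← inv_div ε x, ← one_div (ε / x), le_div_iff₀' h2]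
    exact h1

/-- At order zero the tail of `u` majorizes all the tails, since u_ε ≤ u. One application of x d/dx
gives -x u_ε(x), the negative of `eulerTerm u 0 0`, and the remaining orders follow from the Euler
terms. -/
theorem isMajorizedFamilyOfOrder_tailIntegral {m : ℕ} (hu : IsSubordinatorLevyDensity u)
    (hsmooth : ContDiffOn ℝ m u (Ioi 0))
    (hint : ∀ k : ℕ, k ≤ m → ∀ b : ℝ,
      IntegrableOn (fun x : ℝ => x ^ (k + 1) * iteratedDeriv k u x) (Ioc 0 b))
    {k : ℕ} (hk : k ≤ m) :
    IsMajorizedFamilyOfOrder k fun ε => tailIntegral (uEps u ε) := by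
  have hcont : ∀ ε, ContinuousOn (uEps u ε) (Ioi 0) := fun ε =>
    ((continuousOn_const.div continuousOn_id fun x hx => ne_of_gt hx).rexp).mul
      hsmooth.continuousOn
  have hderiv : ∀ ε, 0 ≤ ε → ∀ x, 0 < x →
      HasDerivAt (tailIntegral (uEps u ε)) (-uEps u ε x) x := fun ε hε x hx =>
    (hu.uEps hε).hasDerivAt_tailIntegral (hcont ε) hx
  have h0 : IsMajorizedFamily fun ε => tailIntegral (uEps u ε) := by
    refine ⟨fun ε hε x hx => (hderiv ε hε x hx).continuousAt.continuousWithinAt, fun x hx => ?_,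
      fun b _ => ⟨_, hu.isMajorant_tailIntegral b, fun ε hε x hx => ?_⟩⟩
    · refine tendsto_integral_filter_of_dominated_convergence u ?_ ?_ (hu.integrableOn_Ioi hx) ?_
      · filter_upwards [self_mem_nhdsWithin] with ε hε
        exact ((hu.uEps (le_of_lt hε)).integrableOn_Ioi hx).aestronglyMeasurable
      · filter_upwards [self_mem_nhdsWithin] with ε hε
        filter_upwards [ae_restrict_mem measurableSet_Ioi] with y hy
        rw [Real.norm_of_nonneg (uEps_nonneg hu ε (hx.trans hy))]
        exact uEps_le hu (le_of_lt hε) (hx.trans hy)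
      · refine Eventually.of_forall fun y => ?_
        have h1 : Continuous fun ε => uEps u ε y := by
          unfold uEps
          fun_prop
        exact (h1.tendsto 0).mono_left nhdsWithin_le_nhds
    · rw [abs_of_nonneg (((hu.uEps hε).isMajorant_tailIntegral b).nonneg x hx)]
      exact setIntegral_mono_on ((hu.uEps hε).integrableOn_Ioi hx.1) (hu.integrableOn_Ioi hx.1)
        measurableSet_Ioi fun y hy => uEps_le hu hε (hx.1.trans hy)
  rcases k with _ | k
  · exact h0
  · refine ⟨h0, _, (isMajorizedFamilyOfOrder_eulerTerm hsmooth hint k 0 (j := 0)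
      (by omega)).const_mul (-1), fun ε hε x hx => (hderiv ε hε x hx).congr_deriv ?_⟩
    simp only [eulerTerm, uEps, pow_zero, zero_add, pow_one, iteratedDeriv_zero, neg_div]
    field_simp

end Approximation

/-! ### The convolution algebra of majorized functions -/

/-- A continuous function on `(0, ∞)` which has a majorant on each interval `(0, b)`. -/
abbrev IsMajorizedFun (f : ℝ → ℝ) : Prop := IsMajorizedFamily fun _ => f

theorem IsMajorizedFamily.isMajorizedFun {F : ℝ → ℝ → ℝ} (hF : IsMajorizedFamily F) {ε : ℝ}
    (hε : 0 ≤ ε) : IsMajorizedFun (F ε) where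
  continuousOn _ _ := hF.continuousOn ε hε
  tendsto _ _ := tendsto_const_nhds
  exists_majorant b hb := by
    obtain ⟨H, hH, h⟩ := hF.exists_majorant b hb
    exact ⟨H, hH, fun _ _ => h ε hε⟩

namespace IsMajorizedFun

variable {f g h : ℝ → ℝ}

theorem continuousOn (hf : IsMajorizedFun f) : ContinuousOn f (Ioi 0) :=
  IsMajorizedFamily.continuousOn hf 0 le_rfl

theorem congr (hf : IsMajorizedFun f) (hfg : EqOn g f (Ioi 0)) : IsMajorizedFun g where
  continuousOn _ _ := hf.continuousOn.congr hfg
  tendsto _ _ := tendsto_const_nhds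
  exists_majorant b hb := by
    obtain ⟨H, hH, h⟩ := hf.exists_majorant b hb
    exact ⟨H, hH, fun ε hε x hx => by rw [hfg hx.1]; exact h ε hε x hx⟩

theorem const (c : ℝ) : IsMajorizedFun fun _ => c where
  continuousOn _ _ := continuousOn_const
  tendsto _ _ := tendsto_const_nhds
  exists_majorant _ _ := ⟨_, IsMajorant.const (abs_nonneg c), fun _ _ _ _ => le_rfl⟩

theorem abs (hf : IsMajorizedFun f) : IsMajorizedFun fun x => |f x| where
  continuousOn _ _ := hf.continuousOn.abs
  tendsto _ _ := tendsto_const_nhds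
  exists_majorant b hb := by
    obtain ⟨H, hH, h⟩ := hf.exists_majorant b hb
    exact ⟨H, hH, fun ε hε x hx => by rw [abs_abs]; exact h ε hε x hx⟩

theorem convPow (hf : IsMajorizedFun f) {n : ℕ} (hn : 1 ≤ n) : IsMajorizedFun (convPow f n) :=
  IsMajorizedFamilyOfOrder.convPow (k := 0) hf hn

theorem convPowExists (hf : IsMajorizedFun f) (n : ℕ) : ConvPowExists f n :=
  fun _ hk _ _ hx => IsMajorizedFamily.intervalIntegrable (hf.convPow hk) hf le_rfl hx

theorem intervalIntegrable_mul_sub (hf : IsMajorizedFun f) (hg : IsMajorizedFun g) {x : ℝ}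
    (hx : 0 < x) : IntervalIntegrable (fun y => f y * g (x - y)) volume 0 x :=
  IsMajorizedFamily.intervalIntegrable hf hg le_rfl hx

theorem intervalIntegrable (hf : IsMajorizedFun f) {x : ℝ} (hx : 0 < x) :
    IntervalIntegrable f volume 0 x := by
  simpa using hf.intervalIntegrable_mul_sub (const 1) hx

theorem convolutionExistsAt (hf : IsMajorizedFun f) (hg : IsMajorizedFun g) (x : ℝ) :
    ConvolutionExistsAt ((Ioi 0).indicator f) ((Ioi 0).indicator g) x
      (ContinuousLinearMap.mul ℝ ℝ) volume := by
  have heq : (fun t => ContinuousLinearMap.mul ℝ ℝ ((Ioi 0).indicator f t)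
      ((Ioi 0).indicator g (x - t))) = (Ioo 0 x).indicator fun t => f t * g (x - t) := by
    ext t
    by_cases h1 : 0 < t <;> by_cases h2 : t < x <;> simp [indicator, h1, h2]
  rw [ConvolutionExistsAt, heq, integrable_indicator_iff measurableSet_Ioo]
  rcases le_or_gt x 0 with hx | hx
  · simp [Ioo_eq_empty (not_lt.2 hx)]
  · exact ((intervalIntegrable_iff_integrableOn_Ioc_of_le hx.le).1
      (hf.intervalIntegrable_mul_sub hg hx)).mono_set Ioo_subset_Ioc_self

theorem aestronglyMeasurable (hf : IsMajorizedFun f) :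
    AEStronglyMeasurable ((Ioi 0).indicator f) volume :=
  (aestronglyMeasurable_indicator_iff measurableSet_Ioi).2
    (hf.continuousOn.aestronglyMeasurable measurableSet_Ioi)

end IsMajorizedFun

theorem indicator_halfConv (f g : ℝ → ℝ) : (Ioi 0).indicator (halfConv f g) = halfConv f g := by
  ext x
  by_cases hx : 0 < x
  · simp [hx]
  · simp [hx, halfConv_of_nonpos f g (not_lt.1 hx)]

theorem halfConv_comm (f g : ℝ → ℝ) : halfConv f g = halfConv g f := by
  ext x
  rcases le_or_gt x 0 with hx | hx
  · rw [halfConv_of_nonpos _ _ hx, halfConv_of_nonpos _ _ hx]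
  · rw [halfConv_apply _ _ hx, halfConv_apply _ _ hx]
    have := intervalIntegral.integral_comp_sub_left (a := 0) (b := x) (fun y => g y * f (x - y)) x
    rw [sub_self, sub_zero] at this
    rw [← this]
    congr 1 with y
    rw [sub_sub_cancel, mul_comm]

/-- This is associativity of convolution on ℝ for the extensions by zero. The absolute convergence
it needs holds because absolute values and convolutions of majorized functions are majorized. -/
theorem halfConv_assoc {f g h : ℝ → ℝ} (hf : IsMajorizedFun f) (hg : IsMajorizedFun g)
    (hh : IsMajorizedFun h) : halfConv (halfConv f g) h = halfConv f (halfConv g h) := by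
  have hnorm : ∀ f : ℝ → ℝ, (fun x => ‖(Ioi 0).indicator f x‖) =
      (Ioi 0).indicator fun x => |f x| := fun f => by
    ext x
    by_cases hx : 0 < x <;> simp [hx]
  have hpos : ∀ f g : ℝ → ℝ, convolution ((Ioi 0).indicator f) ((Ioi 0).indicator g)
      (ContinuousLinearMap.mul ℝ ℝ) volume = halfConv f g := fun f g =>
    (posConvolution_eq_convolution_indicator f g _ volume).symm
  ext x
  rw [← hpos (halfConv f g), ← hpos f (halfConv g h), indicator_halfConv, indicator_halfConv,
    ← hpos f g, ← hpos g h]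
  refine convolution_assoc _ _ _ _ (fun x y z => mul_assoc x y z) hf.aestronglyMeasurable
    hg.aestronglyMeasurable hh.aestronglyMeasurable
    (Eventually.of_forall fun y => hf.convolutionExistsAt hg y)
    (Eventually.of_forall fun y => ?_) ?_
  · rw [hnorm, hnorm]
    exact hg.abs.convolutionExistsAt hh.abs y
  · rw [hnorm, hnorm, hnorm, hpos, ← indicator_halfConv]
    exact hf.abs.convolutionExistsAt (IsMajorizedFamily.halfConv hg.abs hh.abs) x

theorem halfConv_add {f g h : ℝ → ℝ} (hf : IsMajorizedFun f) (hg : IsMajorizedFun g)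
    (hh : IsMajorizedFun h) : halfConv f (g + h) = halfConv f g + halfConv f h := by
  ext x
  rcases le_or_gt x 0 with hx | hx
  · simp [halfConv_of_nonpos _ _ hx]
  · simp only [Pi.add_apply, halfConv_apply _ _ hx, mul_add]
    exact intervalIntegral.integral_add (hf.intervalIntegrable_mul_sub hg hx)
      (hf.intervalIntegrable_mul_sub hh hx)

theorem halfConv_smul (c : ℝ) (f g : ℝ → ℝ) : halfConv f (c • g) = c • halfConv f g := by
  ext x
  rcases le_or_gt x 0 with hx | hx
  · simp [halfConv_of_nonpos _ _ hx]
  · simp only [Pi.smul_apply, smul_eq_mul, halfConv_apply _ _ hx]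
    rw [← intervalIntegral.integral_const_mul]
    congr 1 with y
    ring

theorem convPow_congr {f g : ℝ → ℝ} (h : EqOn f g (Ioi 0)) :
    ∀ n, EqOn (convPow f n) (convPow g n) (Ioi 0)
  | 0 => fun _ _ => rfl
  | 1 => h
  | n + 2 => fun x _ => congrFun (halfConv_congr (convPow_congr h (n + 1)) h) x

/-- The functions on `ℝ` which vanish on `(-∞, 0]` and are continuous and locally majorized on
`(0, ∞)`. -/
def majorizedSubmodule : Submodule ℝ (ℝ → ℝ) where
  carrier := {f | IsMajorizedFun f ∧ ∀ x ≤ 0, f x = 0}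
  add_mem' hf hg := ⟨IsMajorizedFamily.add hf.1 hg.1, fun x hx => by
    rw [Pi.add_apply, hf.2 x hx, hg.2 x hx, add_zero]⟩
  zero_mem' := ⟨IsMajorizedFun.const 0, fun _ _ => rfl⟩
  smul_mem' c _ hf := ⟨IsMajorizedFamily.const_mul hf.1 c, fun x hx => by
    rw [Pi.smul_apply, hf.2 x hx, smul_zero]⟩

namespace majorizedSubmodule

/-- The restriction of a majorized function to `(0, ∞)`, extended by `0`. -/
noncomputable def restrict (f : ℝ → ℝ) (hf : IsMajorizedFun f) : majorizedSubmodule :=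
  ⟨(Ioi 0).indicator f, hf.congr fun _ hx => indicator_of_mem hx f,
    fun _ hx => indicator_of_notMem (not_lt.2 hx) f⟩

theorem restrict_apply {f : ℝ → ℝ} (hf : IsMajorizedFun f) {x : ℝ} (hx : 0 < x) :
    (restrict f hf).1 x = f x :=
  indicator_of_mem (s := Ioi 0) hx f

theorem ext_pos {s t : majorizedSubmodule} (h : ∀ x, 0 < x → s.1 x = t.1 x) : s = t := by
  refine Subtype.ext (funext fun x => ?_)
  rcases le_or_gt x 0 with hx | hx
  · rw [s.2.2 x hx, t.2.2 x hx]
  · exact h x hx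

noncomputable instance : Mul majorizedSubmodule :=
  ⟨fun s t => ⟨halfConv s.1 t.1, IsMajorizedFamily.halfConv s.2.1 t.2.1,
    fun _ hx => halfConv_of_nonpos _ _ hx⟩⟩

theorem coe_mul (s t : majorizedSubmodule) : (s * t).1 = halfConv s.1 t.1 := rfl

theorem mul_comm' (s t : majorizedSubmodule) : s * t = t * s :=
  Subtype.ext (halfConv_comm _ _)

theorem mul_add' (s t r : majorizedSubmodule) : s * (t + r) = s * t + s * r :=
  Subtype.ext (halfConv_add s.2.1 t.2.1 r.2.1)

theorem mul_smul' (c : ℝ) (s t : majorizedSubmodule) : s * (c • t) = c • (s * t) :=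
  Subtype.ext (halfConv_smul c _ _)

theorem mul_zero' (s : majorizedSubmodule) : s * 0 = 0 := by
  simpa using mul_smul' 0 s 0

/-- The unit for convolution would be the Dirac mass at 0, which is not a function. `Unitization ℝ
majorizedSubmodule` adjoins it, and the compatibility instances below make that a commutative real
algebra where the binomial theorem applies. -/
noncomputable instance : NonUnitalCommRing majorizedSubmodule where
  left_distrib := mul_add'
  right_distrib s t r := by rw [mul_comm' _ r, mul_comm' _ r, mul_comm' _ r, mul_add']
  zero_mul s := by rw [mul_comm', mul_zero']
  mul_zero := mul_zero'
  mul_assoc s t r := Subtype.ext (halfConv_assoc s.2.1 t.2.1 r.2.1)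
  mul_comm := mul_comm'

instance : SMulCommClass ℝ majorizedSubmodule majorizedSubmodule :=
  ⟨fun c s t => (mul_smul' c s t).symm⟩

instance : IsScalarTower ℝ majorizedSubmodule majorizedSubmodule :=
  ⟨fun c s t => by
    rw [smul_eq_mul, smul_eq_mul, mul_comm', mul_smul', mul_comm']⟩

/-! ### Integration as multiplication, and the derivative formula -/

/-- The constant function `1` on `(0, ∞)`. -/
noncomputable def heaviside : majorizedSubmodule := restrict (fun _ => 1) (IsMajorizedFun.const 1)

theorem heaviside_mul_apply (s : majorizedSubmodule) {x : ℝ} (hx : 0 < x) :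
    (heaviside * s).1 x = ∫ y in 0..x, s.1 y := by
  rw [mul_comm', coe_mul, halfConv_apply _ _ hx]
  refine intervalIntegral.integral_congr_ae ?_
  filter_upwards [ae_mem_Ioo_of_mem_uIoc hx.le] with y hy hy'
  rw [heaviside, restrict_apply _ (sub_pos.2 (hy hy').2), mul_one]

theorem hasDerivAt_heaviside_mul (s : majorizedSubmodule) {x : ℝ} (hx : 0 < x) :
    HasDerivAt (heaviside * s).1 (s.1 x) x := by
  have hc := s.2.1.continuousOn
  refine (intervalIntegral.integral_hasDerivAt_right (s.2.1.intervalIntegrable hx)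
    (hc.stronglyMeasurableAtFilter isOpen_Ioi x hx)
    (hc.continuousAt (Ioi_mem_nhds hx))).congr_of_eventuallyEq ?_
  filter_upwards [Ioi_mem_nhds hx] with y hy
  exact heaviside_mul_apply s hy

/-- Multiplication by `heaviside` is integration from 0, so each derivative strips one factor.
Stating it in the unitization gives the zeroth power a meaning. -/
theorem iteratedDeriv_of_eq_heaviside_pow_mul (n : ℕ) {s t : majorizedSubmodule}
    (h : (t : Unitization ℝ majorizedSubmodule) =
      (heaviside : Unitization ℝ majorizedSubmodule) ^ n * s) :
    EqOn (iteratedDeriv n t.1) s.1 (Ioi 0) := by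
  induction n generalizing s with
  | zero =>
    rw [pow_zero, one_mul, Unitization.inr_injective.eq_iff] at h
    subst h
    exact fun x _ => rfl
  | succ n ih =>
    rw [pow_succ, mul_assoc, ← Unitization.inr_mul] at h
    intro x hx
    rw [iteratedDeriv_succ, ((ih h).eventuallyEq_of_mem (Ioi_mem_nhds hx)).deriv_eq]
    exact (hasDerivAt_heaviside_mul s hx).deriv

theorem inr_pow_succ (s : majorizedSubmodule) (k : ℕ) :
    (s : Unitization ℝ majorizedSubmodule) ^ (k + 1) =
      (restrict (convPow s.1 (k + 1)) (s.2.1.convPow k.succ_pos) : majorizedSubmodule) := by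
  induction k with
  | zero =>
    refine (pow_one _).trans (congrArg _ (ext_pos fun x hx => ?_))
    exact (restrict_apply (s.2.1.convPow le_rfl) hx).symm
  | succ k ih =>
    rw [pow_succ, ih, ← Unitization.inr_mul]
    refine congrArg _ (ext_pos fun x hx => ?_)
    rw [restrict_apply _ hx, coe_mul]
    exact congrFun (halfConv_congr (fun y hy => restrict_apply _ hy) fun _ _ => rfl) x

theorem inr_restrict_pow_succ {f : ℝ → ℝ} (hf : IsMajorizedFun f) (k : ℕ) :
    (restrict f hf : Unitization ℝ majorizedSubmodule) ^ (k + 1) =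
      (restrict (convPow f (k + 1)) (hf.convPow k.succ_pos) : majorizedSubmodule) := by
  rw [inr_pow_succ]
  refine congrArg _ (ext_pos fun x hx => ?_)
  rw [restrict_apply _ hx, restrict_apply _ hx]
  exact convPow_congr (fun y hy => restrict_apply hf hy) _ hx

/-- The tail is the total mass minus the integral from 0 to x, so `heaviside` factors out of it in
the unitization. -/
theorem restrict_tailIntegral {u : ℝ → ℝ} (hu : IsMajorizedFun u) (hui : IntegrableOn u (Ioi 0))
    (hV : IsMajorizedFun (tailIntegral u)) :
    restrict (tailIntegral u) hV =
      (∫ x in Ioi 0, u x) • heaviside - heaviside * restrict u hu := by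
  refine ext_pos fun x hx => ?_
  have h1 : ∫ y in 0..x, (restrict u hu).1 y = ∫ y in 0..x, u y := by
    refine intervalIntegral.integral_congr_ae ?_
    filter_upwards [ae_mem_Ioo_of_mem_uIoc hx.le] with y hy hy'
    exact restrict_apply hu (hy hy').1
  have h2 : (heaviside : majorizedSubmodule).1 x = 1 := restrict_apply _ hx
  rw [restrict_apply _ hx, Submodule.coe_sub, Pi.sub_apply, heaviside_mul_apply _ hx, h1,
    Submodule.coe_smul, Pi.smul_apply, h2, smul_eq_mul, mul_one, tailIntegral,
    ← intervalIntegral.integral_Ioi_sub_Ioi' hui (hui.mono_set (Ioi_subset_Ioi hx.le)),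
    sub_sub_cancel]

end majorizedSubmodule

-- With V the tail, E = `heaviside`, W = u and c the total mass, V = E(c - W), so V^n = E^n (c -
-- W)^n. Expanding and differentiating n times leaves the binomial sum without its k = 0 term, which
-- is c^n times the adjoined unit and differentiates to zero on (0, ∞).
open majorizedSubmodule in
theorem iteratedDeriv_convPow_tailIntegral {u : ℝ → ℝ} (hu : IsMajorizedFun u)
    (hui : IntegrableOn u (Ioi 0)) (hV : IsMajorizedFun (tailIntegral u)) {n : ℕ} (hn : 1 ≤ n)
    {x : ℝ} (hx : 0 < x) :
    iteratedDeriv n (convPow (tailIntegral u) n) x =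
      ∑ k ∈ Finset.Icc 1 n, (-1 : ℝ) ^ k * (n.choose k : ℝ) * convPow u k x *
        (∫ y in Ioi 0, u y) ^ (n - k) := by
  obtain ⟨n, rfl⟩ : ∃ n', n = n' + 1 := ⟨n - 1, by omega⟩
  set c := ∫ y in Ioi 0, u y
  let E : Unitization ℝ majorizedSubmodule := heaviside
  let W : Unitization ℝ majorizedSubmodule := restrict u hu
  let g : majorizedSubmodule := ∑ k ∈ Finset.range (n + 1),
    ((-1 : ℝ) ^ (k + 1) * ((n + 1).choose (k + 1) : ℝ) * c ^ (n - k)) •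
      restrict (convPow u (k + 1)) (hu.convPow k.succ_pos)
  have hbin : (algebraMap ℝ _ c - W) ^ (n + 1) =
      (g : Unitization ℝ majorizedSubmodule) + algebraMap ℝ _ (c ^ (n + 1)) := by
    rw [sub_eq_add_neg, add_comm, add_pow, Finset.sum_range_succ']
    congr 1
    · rw [← Unitization.inrHom_apply ℝ ℝ majorizedSubmodule g, map_sum]
      refine Finset.sum_congr rfl fun k _ => ?_
      rw [map_smul, Unitization.inrHom_apply, ← inr_restrict_pow_succ hu, neg_pow,
        Nat.add_sub_add_right, Algebra.smul_def]
      simp only [map_mul, map_pow, map_neg, map_one, map_natCast]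
      ring
    · simp
  -- One factor E is kept back: the scalar part of the expansion becomes a function only after
  -- multiplication by E. The last derivative is then taken by hand and kills the constant c^{n+1}.
  have hpow : (restrict (convPow (tailIntegral u) (n + 1)) (hV.convPow n.succ_pos) :
      Unitization ℝ majorizedSubmodule) =
      E ^ n * (heaviside * g + c ^ (n + 1) • heaviside : majorizedSubmodule) := by
    have h1 : (restrict (tailIntegral u) hV : Unitization ℝ majorizedSubmodule) =
        E * (algebraMap ℝ _ c - W) := by
      rw [restrict_tailIntegral hu hui hV, Unitization.inr_sub, Unitization.inr_smul,
        Unitization.inr_mul, Algebra.smul_def]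
      ring
    rw [← inr_restrict_pow_succ hV, h1, mul_pow, hbin, Unitization.inr_add, Unitization.inr_smul,
      Unitization.inr_mul, Algebra.smul_def]
    ring
  have heq : EqOn (convPow (tailIntegral u) (n + 1))
      (restrict (convPow (tailIntegral u) (n + 1)) (hV.convPow n.succ_pos)).1 (Ioi 0) :=
    fun y hy => (restrict_apply _ hy).symm
  have hder : EqOn (iteratedDeriv n (convPow (tailIntegral u) (n + 1)))
      (fun y => (heaviside * g).1 y + c ^ (n + 1)) (Ioi 0) := fun y hy => by
    have h2 : (heaviside : majorizedSubmodule).1 y = 1 := restrict_apply _ hy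
    rw [(heq.eventuallyEq_of_mem (Ioi_mem_nhds hy)).iteratedDeriv_eq n,
      iteratedDeriv_of_eq_heaviside_pow_mul n hpow hy, Submodule.coe_add, Submodule.coe_smul,
      Pi.add_apply, Pi.smul_apply, h2, smul_eq_mul, mul_one]
  rw [iteratedDeriv_succ, (hder.eventuallyEq_of_mem (Ioi_mem_nhds hx)).deriv_eq,
    ((hasDerivAt_heaviside_mul g hx).add_const _).deriv,
    ← Finset.Ico_add_one_right_eq_Icc, Finset.sum_Ico_eq_sum_range, Submodule.coe_sum,
    Finset.sum_apply]
  refine Finset.sum_congr (by simp) fun k _ => ?_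
  rw [Submodule.coe_smul, Pi.smul_apply, restrict_apply _ hx, smul_eq_mul, add_comm 1 k,
    Nat.add_sub_add_right]
  ring

/-! ### Regularity of the tail powers and the limit -/

theorem theorem3 (u : ℝ → ℝ) (hu : IsSubordinatorLevyDensity u)
    (n m : ℕ) (hn : 1 ≤ n) (hm : n + 2 ≤ m) (r : ℝ) (hr : 0 < r)
    (hsmooth : ContDiffOn ℝ m u (Ioi 0))
    (hint : ∀ k : ℕ, k ≤ m →
      IntegrableOn (fun x : ℝ => Real.exp (-r * x) * x ^ (k + 1) * |iteratedDeriv k u x|)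
        (Ioi 0)) :
    ((∀ x : ℝ, 0 < x → IntegrableOn u (Ioi x)) ∧
      ConvPowExists (tailIntegral u) n ∧
      ContDiffOn ℝ n (convPow (tailIntegral u) n) (Ioi 0)) ∧
    ((∀ ε : ℝ, 0 < ε →
        IntegrableOn (uEps u ε) (Ioi 0) ∧ ConvPowExists (uEps u ε) n) ∧
      ∀ x : ℝ, 0 < x →
        Tendsto (fun ε : ℝ => unEps u n ε x) (𝓝[>] 0)
          (𝓝 ((-1 : ℝ) ^ n * iteratedDeriv n (convPow (tailIntegral u) n) x))) := by
  -- On (0, b] the weight e^{-rx} is at least e^{-rb}, so it can be dropped; only local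
  -- integrability at 0 is needed.
  have hloc : ∀ k : ℕ, k ≤ m → ∀ b : ℝ,
      IntegrableOn (fun x : ℝ => x ^ (k + 1) * iteratedDeriv k u x) (Ioc 0 b) := by
    intro k hk b
    refine Integrable.mono' (((hint k hk).mono_set Ioc_subset_Ioi_self).const_mul
      (Real.exp (r * b))) ?_ ?_
    · exact ((continuousOn_id.pow (k + 1)).mul ((hsmooth.continuousOn_iteratedDeriv isOpen_Ioi
        hk).mono Ioc_subset_Ioi_self)).aestronglyMeasurable measurableSet_Ioc
    · filter_upwards [ae_restrict_mem measurableSet_Ioc] with x hx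
      rw [norm_mul, Real.norm_of_nonneg (pow_nonneg hx.1.le _), Real.norm_eq_abs, mul_assoc,
        ← mul_assoc, ← Real.exp_add]
      refine le_mul_of_one_le_left (mul_nonneg (pow_nonneg hx.1.le _) (abs_nonneg _))
        (Real.one_le_exp ?_)
      nlinarith [hx.2]
  have hV := isMajorizedFamilyOfOrder_tailIntegral hu hsmooth hloc (k := n) (by omega)
  have hVfun : ∀ ε, 0 ≤ ε → IsMajorizedFun (tailIntegral (uEps u ε)) := fun ε hε =>
    hV.isMajorizedFamily.isMajorizedFun hε
  have hVn := hV.convPow hn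
  have hufun : ∀ ε, 0 < ε → IsMajorizedFun (uEps u ε) := by
    intro ε hε
    -- For fixed ε > 0, u_ε(x) = ε^{-1} · (ε/x) e^{-ε/x} · x u(x), an Euler term with `i = 1`, `j =
    -- 0`. The resulting majorant depends on `ε`, which is harmless here.
    have h1 := (isMajorizedFamily_eulerTerm hsmooth hloc 1 (j := 0) (by omega)).isMajorizedFun hε.le
    refine IsMajorizedFun.congr (IsMajorizedFamily.const_mul h1 ε⁻¹) fun x hx => ?_
    have hx : x ≠ 0 := ne_of_gt hx
    simp only [eulerTerm, uEps, iteratedDeriv_zero, neg_div]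
    field_simp
    ring
  refine ⟨⟨fun x hx => hu.integrableOn_Ioi hx, ?_, ?_⟩, fun ε hε =>
    ⟨hu.integrableOn_uEps hε, (hufun ε hε).convPowExists n⟩, fun x hx => ?_⟩
  · simpa only [uEps_zero] using (hVfun 0 le_rfl).convPowExists n
  · simpa only [uEps_zero] using hVn.contDiffOn le_rfl
  -- The n-th derivatives of the tail powers converge as ε ↓ 0; for each ε > 0 the algebraic formula
  -- identifies them, up to sign, with u_{nε}.
  · have hlim := (hVn.tendsto_iteratedDeriv hx).const_mul ((-1 : ℝ) ^ n)
    rw [uEps_zero] at hlim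
    refine hlim.congr' ?_
    filter_upwards [self_mem_nhdsWithin] with ε hε
    rw [iteratedDeriv_convPow_tailIntegral (hufun ε hε) (hu.integrableOn_uEps hε)
      (hVfun ε (le_of_lt hε)) hn hx, unEps, Finset.mul_sum]
    refine Finset.sum_congr rfl fun k hk => ?_
    have hk := (Finset.mem_Icc.1 hk).2
    have hsign : (-1 : ℝ) ^ n * (-1) ^ k = (-1) ^ (n - k) := by
      obtain ⟨d, rfl⟩ := Nat.exists_eq_add_of_le hk
      rw [Nat.add_sub_cancel_left, pow_add, mul_right_comm, ← mul_pow]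
      simp
    rw [← hsign, cEps]
    ring
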